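/- Let $X$ be a (real) Banach space, $C\subseteq X$ a closed convex set, and $T:C\to C$ a nonexpansive map, i.e. $\|Tx-Ty\|\le\|x-y\|$ for all $x,y\in C$. Let $\alpha_n\in[0,1]$ and $e_n\in X$ for $n\ge 1$, and $\gamma_n\ge 0$ for $n\ge 0$. Let $x_0\in C$ and let the sequences $(x_n)_{n\ge0}$ in $X$ and $(z_n)_{n\ge0}$ in $C$ satisfy, for all $n\ge 0$, $$z_n\in C,\qquad \|z_n-x_n\|\le d(x_n,C)+\gamma_n,\qquad x_{n+1}=(1-\alpha_{n+1})x_n+\alpha_{n+1}(Tz_n+e_{n+1}),$$ where $d(x,C)=\inf_{c\in C}\|x-c\|$. Assume that $$\|e_n\|\to 0,\qquad \sum_{k\ge1}(\alpha_k\|e_k\|+\gamma_k)<\infty,\qquad \sum_{k\ge1}\alpha_k(1-\alpha_k)=\infty,$$ and that there is $\kappa\ge 0$ with $\|x_0-Tz_n\|\le\kappa$ for all $n\ge 0$. Then $$\|x_n-z_n\|\to 0\qquad\text{and}\qquad \|z_n-Tz_n\|\to 0.$$ Moreover: a) If $T(C)$ is relatively compact, then $x_n$ converges strongly to a fixed point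 of $T$. b) If $(x_n)$ is bounded and $X$ is uniformly convex and has Opial's property, then $x_n$ converges weakly to a fixed point of $T$. Here Opial's property means that whenever $u_n\rightharpoonup u$ weakly in $X$, one has $\liminf_{n\to\infty}\|u_n-u\|<\liminf_{n\to\infty}\|u_n-v\|$ for every $v\ne u$. -/

import Mathlib

open Filter Topology

/-- Weak convergence `u n ⇀ p` of a sequence in a real normed space. -/
def WeaklyConverges {X : Type*} [NormedAddCommGroup X] [NormedSpace ℝ X]
    (u : ℕ → X) (p : X) : Prop :=
  Tendsto (fun n => toWeakSpace ℝ X (u n)) atTop (𝓝 (toWeakSpace ℝ X p))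

/-- Opial's property: whenever `u n ⇀ p`, one has
`liminf ‖u n - p‖ < liminf ‖u n - q‖` for every `q ≠ p`.
The real `liminf`s carry no junk value, as weakly convergent sequences are bounded. -/
def OpialProperty (X : Type*) [NormedAddCommGroup X] [NormedSpace ℝ X] : Prop :=
  ∀ (u : ℕ → X) (p : X), WeaklyConverges u p →
    ∀ q : X, q ≠ p →
      liminf (fun n => ‖u n - p‖) atTop < liminf (fun n => ‖u n - q‖) atTop

/-- The pair `(x, z)` is generated by the inexact Krasnosel'skii-Mann iteration with approximate
projections onto `C`: starting from `x 0 ∈ C`, take `z n ∈ C` with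
`‖z n - x n‖ ≤ d(x n, C) + γ n` and set
`x (n+1) = (1 - α (n+1)) x n + α (n+1) (T (z n) + e (n+1))`.
Only the values of `T` on `C`, and of `α`, `e` at indices `≥ 1`, are used. -/
structure IsApproxProjKM {X : Type*} [NormedAddCommGroup X] [NormedSpace ℝ X]
    (C : Set X) (T : X → X) (α γ : ℕ → ℝ) (e x z : ℕ → X) : Prop where
  start_mem : x 0 ∈ C
  proj_mem : ∀ n, z n ∈ C
  proj_approx : ∀ n, ‖z n - x n‖ ≤ Metric.infDist (x n) C + γ n
  step : ∀ n, x (n + 1) = (1 - α (n + 1)) • x n + α (n + 1) • (T (z n) + e (n + 1))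

/-! ### Weak sequential compactness of bounded sets in uniformly convex spaces. -/

section UniformlyConvex

variable {X : Type*} [NormedAddCommGroup X] [NormedSpace ℝ X]

/-! Put `w n = T (z n)` and `ε n = d(x n, C) + γ n`. Nonexpansiveness gives `‖w m - w n‖ ≤ ‖x m - x
n‖ + ε m + ε n`, so `x` is an averaged iteration of an almost nonexpansive map. Unrolling two
iterates backwards in time bounds `‖x n - w n‖` by a constant times the probability that a lazy
symmetric walk started at 1, with step probabilities `α (1 - α)`, has not yet hit 0, plus
accumulated errors (`norm_sub_le_jumpExpectation`). Divergence of `∑ α (1 - α)` forces absorption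
(`tendsto_lazyWalkSurvival_one`), and restarting the iteration at a late index makes the errors
small (`tendsto_norm_sub_of_averagedIteration`).

The errors are controlled by convexity of `C`: the distances contract, `d (n+1) ≤ (1 - α (n+1)) d n
+ α (n+1) ‖e (n+1)‖`, so `∑ α (n+1) d n` converges and `d n → 0`.

For every fixed point `p`, `‖x n - p‖` changes upwards only by summable amounts, hence converges.
Under compactness, a subsequential limit is a fixed point and therefore the limit. Under Opial's
property, weak cluster points are fixed points, and two distinct ones `p`, `q` would give opposite
strict inequalities between `lim ‖x n - p‖` and `lim ‖x n - q‖`. Weak cluster points exist because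
uniform convexity makes almost minimal vectors in a directed family of closed convex sets Cauchy. -/

theorem weaklyConverges_iff {u : ℕ → X} {p : X} :
    WeaklyConverges u p ↔ ∀ f : StrongDual ℝ X, Tendsto (fun n => f (u n)) atTop (𝓝 (f p)) := by
  refine WeakBilin.tendsto_iff_forall_eval_tendsto _ ?_
  intro a b hab
  by_contra hne
  obtain ⟨f, hf⟩ := SeparatingDual.exists_separating_of_ne (R := ℝ) hne
  exact hf (LinearMap.congr_fun hab f)

/-- Almost minimal vectors with an almost minimal midpoint are close to each other. -/
theorem UniformConvexSpace.exists_norm_sub_lt [UniformConvexSpace X] {ε R : ℝ} (hε : 0 < ε)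
    (hR : 0 ≤ R) :
    ∃ η > 0, ∀ x y : X, ‖x‖ ≤ R + η → ‖y‖ ≤ R + η → 2 * (R - η) ≤ ‖x + y‖ → ‖x - y‖ < ε := by
  rcases hR.eq_or_lt with rfl | hR
  · refine ⟨ε / 3, by positivity, fun x y hx hy _ => ?_⟩
    have := norm_sub_le x y
    linarith
  obtain ⟨δ, hδ, h⟩ := exists_forall_closed_ball_dist_add_le_two_sub X
    (div_pos hε (by linarith : 0 < R + 1))
  -- The bound `η ≤ 1` keeps the rescaled distance at least `ε / (R + 1)`. The bound `η ≤ δ R / 8`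
  -- makes `2 (R - η) ≤ (2 - δ) (R + η)` impossible.
  have hη : 0 < min 1 (δ * R / 8) := by positivity
  set η := min 1 (δ * R / 8) with hηdef
  have hη1 : η ≤ 1 := min_le_left _ _
  have hη2 : η ≤ δ * R / 8 := min_le_right _ _
  refine ⟨η, hη, fun x y hx hy hxy => ?_⟩
  by_contra! hcon
  have hr : 0 < R + η := by linarith
  have hscale : ∀ v : X, ‖(R + η)⁻¹ • v‖ = ‖v‖ / (R + η) := fun v => by
    rw [norm_smul, Real.norm_of_nonneg (inv_nonneg.2 hr.le), div_eq_inv_mul]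
  have key := h (x := (R + η)⁻¹ • x) (by rw [hscale, div_le_one hr]; exact hx)
    (y := (R + η)⁻¹ • y) (by rw [hscale, div_le_one hr]; exact hy) (by
      rw [← smul_sub, hscale]
      gcongr)
  rw [← smul_add, hscale, div_le_iff₀ hr] at key
  nlinarith [mul_pos hδ hη]

/-- In a uniformly convex Banach space, a directed family of nonempty closed convex sets that all
meet a fixed ball has a common point. -/
theorem UniformConvexSpace.nonempty_iInter_of_directed [CompleteSpace X] [UniformConvexSpace X]
    {ι : Type*} [Nonempty ι] (K : ι → Set X) (hdir : Directed (· ⊇ ·) K)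
    (hclosed : ∀ i, IsClosed (K i)) (hconv : ∀ i, Convex ℝ (K i)) {M : ℝ}
    (hM : ∀ i, ∃ v ∈ K i, ‖v‖ ≤ M) : (⋂ i, K i).Nonempty := by
  have hne : ∀ i, (K i).Nonempty := fun i => (hM i).imp fun v hv => hv.1
  have hbdd : BddAbove (Set.range fun i => Metric.infDist 0 (K i)) := by
    refine ⟨M, ?_⟩
    rintro _ ⟨i, rfl⟩
    obtain ⟨v, hv, hvM⟩ := hM i
    refine (Metric.infDist_le_dist_of_mem hv).trans ?_
    rwa [dist_zero_left]
  set R := ⨆ i, Metric.infDist 0 (K i) with hRdef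
  have hle : ∀ i, Metric.infDist 0 (K i) ≤ R := fun i => le_ciSup hbdd i
  have hR : 0 ≤ R := Metric.infDist_nonneg.trans (hle (Classical.arbitrary ι))
  -- These sets generate a filter. It is Cauchy because midpoints stay in `K i`, whose distance from
  -- 0 can be taken above `R - η`.
  let S : ι × {η : ℝ // 0 < η} → Set X := fun a => K a.1 ∩ {v | ‖v‖ ≤ R + a.2.1}
  have hSne : ∀ a, (S a).Nonempty := by
    rintro ⟨i, η, hη⟩
    obtain ⟨v, hv, hlt⟩ := (Metric.infDist_lt_iff (r := R + η) (hne i)).1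
      ((hle i).trans_lt (by linarith))
    refine ⟨v, hv, ?_⟩
    rw [dist_zero_left] at hlt
    exact hlt.le
  have : Nonempty (ι × {η : ℝ // 0 < η}) := ⟨(Classical.arbitrary ι, ⟨1, one_pos⟩)⟩
  have hSdir : Directed (· ≥ ·) fun a => 𝓟 (S a) := by
    rintro ⟨i, η, hη⟩ ⟨j, θ, hθ⟩
    obtain ⟨k, hki, hkj⟩ := hdir i j
    refine ⟨(k, ⟨min η θ, lt_min hη hθ⟩), ?_, ?_⟩ <;> refine principal_mono.2 ?_ <;>
      rintro v ⟨hv, hvn⟩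
    · exact ⟨hki hv, (show ‖v‖ ≤ _ from hvn).trans (add_le_add le_rfl (min_le_left _ _))⟩
    · exact ⟨hkj hv, (show ‖v‖ ≤ _ from hvn).trans (add_le_add le_rfl (min_le_right _ _))⟩
  set F : Filter X := ⨅ a, 𝓟 (S a) with hF
  have hSF : ∀ a, S a ∈ F := fun a => mem_iInf_of_mem a (mem_principal_self _)
  have hFne : F.NeBot := iInf_neBot_of_directed' hSdir fun a => principal_neBot_iff.2 (hSne a)
  have hcauchy : Cauchy F := by
    refine Metric.cauchy_iff.2 ⟨hFne, fun ε hε => ?_⟩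
    obtain ⟨η, hη, h⟩ := UniformConvexSpace.exists_norm_sub_lt (X := X) hε hR
    obtain ⟨i, hi⟩ := exists_lt_of_lt_ciSup (by linarith : R - η < ⨆ i, Metric.infDist 0 (K i))
    refine ⟨_, hSF (i, ⟨η, hη⟩), fun x hx y hy => ?_⟩
    rw [dist_eq_norm]
    refine h x y hx.2 hy.2 ?_
    have hmid : (1 / 2 : ℝ) • x + (1 / 2 : ℝ) • y ∈ K i :=
      hconv i hx.1 hy.1 (by norm_num) (by norm_num) (by norm_num)
    have hd := Metric.infDist_le_dist_of_mem (x := 0) hmid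
    rw [dist_zero_left, ← smul_add, norm_smul, Real.norm_of_nonneg (by norm_num)] at hd
    linarith
  obtain ⟨v, hv⟩ := CompleteSpace.complete hcauchy
  refine ⟨v, Set.mem_iInter.2 fun i => ?_⟩
  refine (hclosed i).mem_of_tendsto (f := id) (b := F) hv ?_
  filter_upwards [hSF (i, ⟨1, one_pos⟩)] with w hw using hw.1

/-- Bounded families in a uniformly convex Banach space converge weakly along ultrafilters. -/
theorem UniformConvexSpace.exists_tendsto_ultrafilter [CompleteSpace X] [UniformConvexSpace X]
    {ι : Type*} {u : ι → X} {M : ℝ} (hu : ∀ n, ‖u n‖ ≤ M) (g : Ultrafilter ι) :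
    ∃ p ∈ closedConvexHull ℝ (Set.range u),
      ∀ f : StrongDual ℝ X, Tendsto (fun n => f (u n)) g (𝓝 (f p)) := by
  let K : {A : Set ι // A ∈ g} → Set X := fun A => closedConvexHull ℝ (u '' A.1)
  have hmono : ∀ A B : {A : Set ι // A ∈ g}, A.1 ⊆ B.1 → K A ⊆ K B := fun A B hAB =>
    (closedConvexHull ℝ).monotone (Set.image_mono hAB)
  have : Nonempty {A : Set ι // A ∈ g} := ⟨⟨Set.univ, univ_mem⟩⟩
  obtain ⟨p, hp⟩ := UniformConvexSpace.nonempty_iInter_of_directed (M := M) K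
    (fun A B => ⟨⟨A.1 ∩ B.1, inter_mem A.2 B.2⟩, hmono _ _ Set.inter_subset_left,
      hmono _ _ Set.inter_subset_right⟩)
    (fun A => isClosed_closedConvexHull) (fun A => convex_closedConvexHull) (fun A => by
      obtain ⟨n, hn⟩ := nonempty_of_mem A.2
      exact ⟨u n, subset_closedConvexHull ⟨n, hn, rfl⟩, hu n⟩)
  rw [Set.mem_iInter] at hp
  refine ⟨p, ?_, fun f => ?_⟩
  · simpa [K] using hp ⟨Set.univ, univ_mem⟩
  rw [Metric.tendsto_nhds]
  intro ε hε
  by_contra hcon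
  rw [← Ultrafilter.eventually_not] at hcon
  -- The ultrafilter picks one side. The closed half-space on that side then contains a hull `K A`,
  -- but not its point `p`.
  have hsplit : (∀ᶠ n in (g : Filter ι), f p + ε ≤ f (u n)) ∨
      ∀ᶠ n in (g : Filter ι), f (u n) ≤ f p - ε := by
    rw [← Ultrafilter.eventually_or]
    filter_upwards [hcon] with n hn
    rw [Real.dist_eq, not_lt, le_abs] at hn
    rcases hn with hn | hn
    · left; linarith
    · right; linarith
  rcases hsplit with h | h
  · have hsub : K ⟨_, h⟩ ⊆ {v | f p + ε ≤ f v} := by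
      refine closedConvexHull_min ?_ (convex_halfSpace_ge f.isLinear _)
        (isClosed_le continuous_const f.continuous)
      rintro _ ⟨n, hn, rfl⟩
      exact hn
    have := hsub (hp _)
    simp only [Set.mem_ofPred_eq] at this
    linarith
  · have hsub : K ⟨_, h⟩ ⊆ {v | f v ≤ f p - ε} := by
      refine closedConvexHull_min ?_ (convex_halfSpace_le f.isLinear _)
        (isClosed_le f.continuous continuous_const)
      rintro _ ⟨n, hn, rfl⟩
      exact hn
    have := hsub (hp _)
    simp only [Set.mem_ofPred_eq] at this
    linarith

/-- Countably many functionals in the dual unit ball separate the points of the closed span of a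
sequence. -/
theorem exists_seq_strongDual_separating (u : ℕ → X) :
    ∃ f : ℕ → StrongDual ℝ X, (∀ j, ‖f j‖ ≤ 1) ∧
      ∀ v ∈ (Submodule.span ℝ (Set.range u)).topologicalClosure, (∀ j, f j v = 0) → v = 0 := by
  have hsep : TopologicalSpace.IsSeparable
      ((Submodule.span ℝ (Set.range u)).topologicalClosure : Set X) := by
    rw [Submodule.topologicalClosure_coe]
    exact ((Set.countable_range u).isSeparable.span).closure
  obtain ⟨c, hc, hcl⟩ := hsep
  have hcne : c.Nonempty := by
    rw [Set.nonempty_iff_ne_empty]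
    rintro rfl
    simpa using hcl (Submodule.zero_mem _)
  obtain ⟨y, rfl⟩ := hc.exists_eq_range hcne
  choose f hf1 hf using fun j => exists_dual_vector'' ℝ (y j)
  refine ⟨f, hf1, fun v hv hzero => ?_⟩
  by_contra hne
  have hpos : 0 < ‖v‖ := norm_pos_iff.2 hne
  obtain ⟨_, ⟨j, rfl⟩, hj⟩ := Metric.mem_closure_iff.1 (hcl hv) (‖v‖ / 2) (by positivity)
  rw [dist_eq_norm] at hj
  have h1 : ‖f j (y j - v)‖ ≤ ‖y j - v‖ := by
    simpa using (f j).le_of_opNorm_le (hf1 j) (y j - v)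
  rw [map_sub, hzero j, sub_zero, hf j, norm_sub_rev (y j)] at h1
  simp only [RCLike.ofReal_real_eq_id, id, norm_norm] at h1
  have h2 := norm_sub_norm_le v (y j)
  linarith

/-- Bounded sequences in a uniformly convex Banach space have weakly convergent subsequences. -/
theorem UniformConvexSpace.exists_subseq_weaklyConverges [CompleteSpace X] [UniformConvexSpace X]
    {u : ℕ → X} {M : ℝ} (hu : ∀ n, ‖u n‖ ≤ M) :
    ∃ (p : X) (φ : ℕ → ℕ), StrictMono φ ∧ WeaklyConverges (u ∘ φ) p := by
  obtain ⟨f, hf1, hf⟩ := exists_seq_strongDual_separating u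
  have hcomp : IsCompact (Set.pi Set.univ fun _ : ℕ => Set.Icc (-M) M) :=
    isCompact_univ_pi fun _ => isCompact_Icc
  obtain ⟨a, -, φ, hφ, ha⟩ := hcomp.tendsto_subseq (x := fun n j => f j (u n)) fun n j _ => by
    have : ‖f j (u n)‖ ≤ M := by
      refine ((f j).le_of_opNorm_le (hf1 j) (u n)).trans ?_
      rw [one_mul]
      exact hu n
    exact abs_le.1 this
  rw [tendsto_pi_nhds] at ha
  have hspan : closedConvexHull ℝ (Set.range (u ∘ φ)) ⊆
      ((Submodule.span ℝ (Set.range u)).topologicalClosure : Set X) := by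
    refine closedConvexHull_min ?_ (Submodule.convex _) (Submodule.isClosed_topologicalClosure _)
    rintro _ ⟨n, rfl⟩
    exact Submodule.le_topologicalClosure _ (Submodule.subset_span ⟨φ n, rfl⟩)
  -- All ultrafilter limits lie in the closed span and have the same coordinates `a j`, so they
  -- coincide; this gives weak convergence along `φ`.
  have hlim : ∀ g : Ultrafilter ℕ, ↑g ≤ (atTop : Filter ℕ) →
      ∃ p ∈ (Submodule.span ℝ (Set.range u)).topologicalClosure, (∀ j, f j p = a j) ∧
        ∀ f : StrongDual ℝ X, Tendsto (fun n => f ((u ∘ φ) n)) g (𝓝 (f p)) := by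
    intro g hg
    obtain ⟨p, hp, hpl⟩ := UniformConvexSpace.exists_tendsto_ultrafilter
      (u := u ∘ φ) (fun n => hu (φ n)) g
    exact ⟨p, hspan hp, fun j => tendsto_nhds_unique (hpl (f j)) ((ha j).mono_left hg), hpl⟩
  obtain ⟨p, hp, hpa, -⟩ := hlim (Ultrafilter.of atTop) (Ultrafilter.of_le _)
  refine ⟨p, φ, hφ, weaklyConverges_iff.2 fun l => ?_⟩
  rw [tendsto_iff_ultrafilter]
  intro g hg
  obtain ⟨q, hq, hqa, hql⟩ := hlim g hg
  have hqp : q - p = 0 := hf _ (Submodule.sub_mem _ hq hp) fun j => by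
    rw [map_sub, hqa, hpa, sub_self]
  rw [← sub_eq_zero.1 hqp]
  exact hql l

end UniformlyConvex

/-! ### Absorption of the lazy random walk. -/

/-- Probability that a lazy symmetric walk on `ℕ` started at `s`, moving by `±1` with probability
`β m` each at the times `m, m - 1, …, 1`, does not hit `0`. -/
def lazyWalkSurvival (β : ℕ → ℝ) : ℕ → ℕ → ℝ
  | 0, s => if s = 0 then 0 else 1
  | _ + 1, 0 => 0
  | m + 1, s + 1 => (1 - 2 * β (m + 1)) * lazyWalkSurvival β m (s + 1) +
      β (m + 1) * (lazyWalkSurvival β m s + lazyWalkSurvival β m (s + 2))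

section LazyWalk

variable {β : ℕ → ℝ}

theorem lazyWalkSurvival_zero_right (m : ℕ) : lazyWalkSurvival β m 0 = 0 := by
  cases m <;> simp [lazyWalkSurvival]

theorem lazyWalkSurvival_nonneg (hβ : ∀ n, 1 ≤ n → β n ∈ Set.Icc (0 : ℝ) (1 / 4)) (m s : ℕ) :
    0 ≤ lazyWalkSurvival β m s := by
  induction m generalizing s with
  | zero => simp only [lazyWalkSurvival]; split_ifs <;> norm_num
  | succ m ih =>
    cases s with
    | zero => simp [lazyWalkSurvival]
    | succ s =>
      obtain ⟨h0, h1⟩ := hβ (m + 1) (by omega)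
      simp only [lazyWalkSurvival]
      exact add_nonneg (mul_nonneg (by linarith) (ih _))
        (mul_nonneg h0 (add_nonneg (ih _) (ih _)))

theorem lazyWalkSurvival_le_one (hβ : ∀ n, 1 ≤ n → β n ∈ Set.Icc (0 : ℝ) (1 / 4)) (m s : ℕ) :
    lazyWalkSurvival β m s ≤ 1 := by
  induction m generalizing s with
  | zero => simp only [lazyWalkSurvival]; split_ifs <;> norm_num
  | succ m ih =>
    cases s with
    | zero => simp [lazyWalkSurvival]
    | succ s =>
      obtain ⟨h0, h1⟩ := hβ (m + 1) (by omega)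
      simp only [lazyWalkSurvival]
      nlinarith [mul_le_mul_of_nonneg_left (ih (s + 1)) (by linarith : 0 ≤ 1 - 2 * β (m + 1)),
        mul_le_mul_of_nonneg_left (add_le_add (ih s) (ih (s + 2))) h0]

/-- Gambler's ruin on `[0, S]`: `s / S` is harmonic and accounts for reaching `S`. One step lowers
the mean of `s (S - s)` by `2 β`, which is at least the fraction `8 β / S ^ 2` of it, since `s (S -
s) ≤ S ^ 2 / 4`. -/
theorem lazyWalkSurvival_le (hβ : ∀ n, 1 ≤ n → β n ∈ Set.Icc (0 : ℝ) (1 / 4)) {S : ℕ}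
    (hS : 2 ≤ S) (m s : ℕ) (hs : s ≤ S) :
    lazyWalkSurvival β m s ≤ (s : ℝ) / S +
      (∏ k ∈ Finset.Icc 1 m, (1 - 8 / (S : ℝ) ^ 2 * β k)) * (s * (S - s)) := by
  have hS0 : (2 : ℝ) ≤ S := by exact_mod_cast hS
  have hSS : 0 < (S : ℝ) := by linarith
  induction m generalizing s with
  | zero =>
    rcases Nat.eq_zero_or_pos s with rfl | hs0
    · simp [lazyWalkSurvival]
    have h1 : (1 : ℝ) ≤ s := by exact_mod_cast hs0
    simp only [lazyWalkSurvival, hs0.ne', if_false]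
    rcases hs.eq_or_lt with rfl | hlt
    · simp [hSS.ne']
    have h2 : (s : ℝ) + 1 ≤ S := by exact_mod_cast hlt
    have h3 : 0 ≤ (s : ℝ) / S := by positivity
    have : (1 : ℝ) ≤ s * (S - s) := by nlinarith
    simpa using by linarith
  | succ m ih =>
    cases s with
    | zero => simp [lazyWalkSurvival]
    | succ s =>
      rcases hs.eq_or_lt with hs | hs
      · refine (lazyWalkSurvival_le_one hβ _ _).trans ?_
        rw [hs]
        simp [hSS.ne']
      obtain ⟨h0, h1⟩ := hβ (m + 1) (by omega)
      rw [Finset.prod_Icc_succ_top (by omega)]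
      have hρ : 0 ≤ ∏ k ∈ Finset.Icc 1 m, (1 - 8 / (S : ℝ) ^ 2 * β k) := by
        refine Finset.prod_nonneg fun k hk => ?_
        obtain ⟨hk0, hk1⟩ := hβ k (Finset.mem_Icc.1 hk).1
        have : 8 / (S : ℝ) ^ 2 ≤ 2 := by
          rw [div_le_iff₀ (by positivity)]
          nlinarith
        nlinarith
      set ρ := ∏ k ∈ Finset.Icc 1 m, (1 - 8 / (S : ℝ) ^ 2 * β k)
      have i0 := ih s (by omega)
      have i1 := ih (s + 1) (by omega)
      have i2 := ih (s + 2) (by omega)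
      push_cast at i0 i1 i2 ⊢
      simp only [lazyWalkSurvival]
      have hq : 8 / (S : ℝ) ^ 2 * (((s : ℝ) + 1) * (S - (s + 1))) ≤ 2 := by
        rw [div_mul_eq_mul_div, div_le_iff₀ (by positivity)]
        nlinarith [sq_nonneg ((S : ℝ) - 2 * (s + 1))]
      calc _ ≤ (1 - 2 * β (m + 1)) * (((s : ℝ) + 1) / S + ρ * ((s + 1) * (S - (s + 1)))) +
            β (m + 1) * (((s : ℝ) / S + ρ * (s * (S - s))) +
              (((s : ℝ) + 2) / S + ρ * ((s + 2) * (S - (s + 2))))) := by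
            gcongr
            linarith
        _ = ((s : ℝ) + 1) / S + ρ * ((s + 1) * (S - (s + 1))) - ρ * β (m + 1) * 2 := by
            field_simp
            ring
        _ ≤ _ := by
            nlinarith [mul_le_mul_of_nonneg_left hq (mul_nonneg hρ h0)]

/-- The lazy walk started at `1` is absorbed almost surely. -/
theorem tendsto_lazyWalkSurvival_one (hβ : ∀ n, 1 ≤ n → β n ∈ Set.Icc (0 : ℝ) (1 / 4))
    (hdiv : Tendsto (fun n : ℕ => ∑ k ∈ Finset.Icc 1 n, β k) atTop atTop) :
    Tendsto (fun m => lazyWalkSurvival β m 1) atTop (𝓝 0) := by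
  rw [Metric.tendsto_atTop]
  intro ε hε
  obtain ⟨S, hSε⟩ := exists_nat_gt (max 2 (2 / ε))
  have hS2 : (2 : ℝ) < S := (le_max_left _ _).trans_lt hSε
  have hSε' : 2 / ε < S := (le_max_right _ _).trans_lt hSε
  have hS : 2 ≤ S := by exact_mod_cast hS2.le
  have hρ : Tendsto (fun m => Real.exp (-(8 / (S : ℝ) ^ 2 * ∑ k ∈ Finset.Icc 1 m, β k)) * (S - 1))
      atTop (𝓝 (0 * (S - 1))) :=
    (Real.tendsto_exp_neg_atTop_nhds_zero.comp
      (hdiv.const_mul_atTop (by positivity : 0 < 8 / (S : ℝ) ^ 2))).mul_const _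
  rw [zero_mul] at hρ
  obtain ⟨N, hN⟩ := eventually_atTop.1 (hρ.eventually_lt_const (half_pos hε))
  refine ⟨N, fun m hm => ?_⟩
  rw [Real.dist_eq, sub_zero, abs_of_nonneg (lazyWalkSurvival_nonneg hβ _ _)]
  have h1 := lazyWalkSurvival_le hβ hS m 1 (by omega)
  have h2 : ∏ k ∈ Finset.Icc 1 m, (1 - 8 / (S : ℝ) ^ 2 * β k) ≤
      Real.exp (-(8 / (S : ℝ) ^ 2 * ∑ k ∈ Finset.Icc 1 m, β k)) := by
    rw [Finset.mul_sum, ← Finset.sum_neg_distrib, Real.exp_sum]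
    refine Finset.prod_le_prod (fun k hk => ?_) fun k _ => ?_
    · obtain ⟨hk0, hk1⟩ := hβ k (Finset.mem_Icc.1 hk).1
      have : 8 / (S : ℝ) ^ 2 ≤ 2 := by
        rw [div_le_iff₀ (by positivity)]
        nlinarith
      nlinarith
    · have := Real.add_one_le_exp (-(8 / (S : ℝ) ^ 2 * β k))
      linarith
  have h3 : 1 / (S : ℝ) < ε / 2 := by
    rw [div_lt_iff₀ (by positivity)] at hSε' ⊢
    linarith
  have h4 := mul_le_mul_of_nonneg_right h2 (by linarith : (0 : ℝ) ≤ S - 1)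
  have h5 := hN m hm
  push_cast at h1
  rw [one_mul] at h1
  linarith

end LazyWalk

/-! ### Comparison of averaged iterations with random walks. -/

/-- Expectation of `φ (s + J)`, where `J` is the number of successes in independent trials at the
times `m + 1, …, m + k` with success probabilities `α`. -/
def jumpExpectation (α : ℕ → ℝ) (m : ℕ) : ℕ → (ℕ → ℝ) → ℕ → ℝ
  | 0, φ, s => φ s
  | k + 1, φ, s => (1 - α (m + k + 1)) * jumpExpectation α m k φ s +
      α (m + k + 1) * jumpExpectation α m k φ (s + 1)

theorem jumpExpectation_succ (α : ℕ → ℝ) (m k : ℕ) (φ : ℕ → ℝ) (s : ℕ) :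
    jumpExpectation α m (k + 1) φ s = (1 - α (m + k + 1)) * jumpExpectation α m k φ s +
      α (m + k + 1) * jumpExpectation α m k φ (s + 1) := rfl

theorem jumpExpectation_lazyWalkSurvival_zero (α β : ℕ → ℝ) (k s : ℕ) :
    jumpExpectation α 0 k (lazyWalkSurvival β 0) (s + 1) = 1 := by
  induction k generalizing s with
  | zero => simp [jumpExpectation, lazyWalkSurvival]
  | succ k ih => simp [jumpExpectation, ih]

/-- The difference of two independent trials at time `m + 1` is `±1` with probability `α (1 - α)`
each, which is one lazy step. The start `s + 1` is positive and jumps only increase it, so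
absorption does not interfere. -/
theorem jumpExpectation_lazyWalkSurvival_succ (α : ℕ → ℝ) (m k s : ℕ) :
    jumpExpectation α (m + 1) k (lazyWalkSurvival (fun n => α n * (1 - α n)) (m + 1)) (s + 1) =
      (1 - α (m + 1)) *
        jumpExpectation α m (k + 1) (lazyWalkSurvival (fun n => α n * (1 - α n)) m) (s + 1) +
      α (m + 1) *
        jumpExpectation α m (k + 1) (lazyWalkSurvival (fun n => α n * (1 - α n)) m) s := by
  induction k generalizing s with
  | zero =>
    simp only [jumpExpectation, lazyWalkSurvival, add_zero]
    ring
  | succ k ih =>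
    have e1 : m + 1 + k + 1 = m + (k + 1) + 1 := by omega
    rw [jumpExpectation_succ, ih, ih, jumpExpectation_succ α m (k + 1) _ (s + 1),
      jumpExpectation_succ α m (k + 1) _ s, e1]
    ring

section AveragedIteration

variable {X : Type*} [NormedAddCommGroup X] [NormedSpace ℝ X]

theorem norm_sub_convexCombination_le {a : ℝ} (ha : a ∈ Set.Icc (0 : ℝ) 1) (x y v e : X) :
    ‖((1 - a) • x + a • (y + e)) - v‖ ≤ (1 - a) * ‖x - v‖ + a * (‖y - v‖ + ‖e‖) := by
  have hdec : ((1 - a) • x + a • (y + e)) - v = (1 - a) • (x - v) + a • ((y - v) + e) := by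
    module
  rw [hdec]
  refine (norm_add_le _ _).trans ?_
  rw [norm_smul, norm_smul, Real.norm_of_nonneg (sub_nonneg.2 ha.2), Real.norm_of_nonneg ha.1]
  have h1 := norm_add_le (y - v) e
  have h2 := ha.1
  gcongr

variable {α ε : ℕ → ℝ} {e x w : ℕ → X} {K : ℝ}

/-- Comparison of two iterates of a perturbed averaged iteration with a pair of random walks. -/
theorem norm_sub_le_jumpExpectation (hα : ∀ n, 1 ≤ n → α n ∈ Set.Icc (0 : ℝ) 1)
    (hε : ∀ n, 0 ≤ ε n)
    (hstep : ∀ n, x (n + 1) = (1 - α (n + 1)) • x n + α (n + 1) • (w n + e (n + 1)))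
    (hw : ∀ m n, ‖w m - w n‖ ≤ ‖x m - x n‖ + ε m + ε n) (hK : ∀ n, ‖x 0 - w n‖ ≤ K) (m k : ℕ) :
    ‖x m - x (m + k)‖ ≤
        K * jumpExpectation α m k (lazyWalkSurvival (fun n => α n * (1 - α n)) m) 0 +
          ∑ j ∈ Finset.range m, α (j + 1) * (‖e (j + 1)‖ + ε j) +
          ∑ j ∈ Finset.range (m + k), α (j + 1) * (‖e (j + 1)‖ + ε j) ∧
      ‖x m - w (m + k)‖ ≤
        K * jumpExpectation α m k (lazyWalkSurvival (fun n => α n * (1 - α n)) m) 1 +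
          ∑ j ∈ Finset.range m, α (j + 1) * (‖e (j + 1)‖ + ε j) +
          ∑ j ∈ Finset.range (m + k), α (j + 1) * (‖e (j + 1)‖ + ε j) + ε (m + k) := by
  set h := lazyWalkSurvival (fun n => α n * (1 - α n)) with hh
  set Φ : ℕ → ℝ := fun n => ∑ j ∈ Finset.range n, α (j + 1) * (‖e (j + 1)‖ + ε j) with hΦ
  have hΦ0 : ∀ n, 0 ≤ Φ n := fun n => Finset.sum_nonneg fun j _ =>
    mul_nonneg (hα _ (by omega)).1 (add_nonneg (norm_nonneg _) (hε j))
  have hΦs : ∀ n, Φ (n + 1) = Φ n + α (n + 1) * (‖e (n + 1)‖ + ε n) := fun n =>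
    Finset.sum_range_succ _ _
  -- Expanding the later iterate `x (m + k + 1)` reproduces the recursion of `jumpExpectation`.
  have hA : ∀ m, (∀ k, ‖x m - w (m + k)‖ ≤
      K * jumpExpectation α m k (h m) 1 + Φ m + Φ (m + k) + ε (m + k)) →
      ∀ k, ‖x m - x (m + k)‖ ≤ K * jumpExpectation α m k (h m) 0 + Φ m + Φ (m + k) := by
    intro m hB k
    induction k with
    | zero =>
      simp only [jumpExpectation, hh, lazyWalkSurvival_zero_right, add_zero, sub_self, norm_zero,
        mul_zero, zero_add]
      linarith [hΦ0 m]
    | succ k ih =>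
      have ha := hα (m + k + 1) (by omega)
      have hc := norm_sub_convexCombination_le ha (x (m + k)) (w (m + k)) (x m) (e (m + k + 1))
      rw [← hstep, norm_sub_rev, norm_sub_rev _ (x m), norm_sub_rev _ (x m)] at hc
      rw [← add_assoc m k 1, hΦs, jumpExpectation]
      have h1 := mul_le_mul_of_nonneg_left ih (sub_nonneg.2 ha.2)
      have h2 := mul_le_mul_of_nonneg_left (hB k) ha.1
      linarith
  -- Expanding the earlier iterate `x (m + 1)` instead leaves `‖x m - w _‖` and `‖w m - w _‖`; the
  -- latter returns to `hA` at `m`, and the two weights combine into a lazy step.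
  have hB : ∀ m k, ‖x m - w (m + k)‖ ≤
      K * jumpExpectation α m k (h m) 1 + Φ m + Φ (m + k) + ε (m + k) := by
    intro m
    induction m with
    | zero =>
      intro k
      rw [hh, jumpExpectation_lazyWalkSurvival_zero α _ k 0]
      linarith [hK (0 + k), hΦ0 0, hΦ0 (0 + k), hε (0 + k)]
    | succ m ih =>
      intro k
      have ha := hα (m + 1) (by omega)
      have e1 : m + 1 + k = m + (k + 1) := by omega
      have hc := norm_sub_convexCombination_le ha (x m) (w m) (w (m + (k + 1))) (e (m + 1))
      rw [← hstep] at hc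
      rw [hh, jumpExpectation_lazyWalkSurvival_succ α m k 0, ← hh, hΦs, e1]
      have h1 := mul_le_mul_of_nonneg_left (ih (k + 1)) (sub_nonneg.2 ha.2)
      have h2 := mul_le_mul_of_nonneg_left (hA m ih (k + 1)) ha.1
      have h3 := mul_le_mul_of_nonneg_left (hw m (m + (k + 1))) ha.1
      rw [zero_add]
      linarith
  exact ⟨hA m (hB m) k, hB m k⟩

theorem norm_sub_le_lazyWalkSurvival (hα : ∀ n, 1 ≤ n → α n ∈ Set.Icc (0 : ℝ) 1)
    (hε : ∀ n, 0 ≤ ε n)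
    (hstep : ∀ n, x (n + 1) = (1 - α (n + 1)) • x n + α (n + 1) • (w n + e (n + 1)))
    (hw : ∀ m n, ‖w m - w n‖ ≤ ‖x m - x n‖ + ε m + ε n) (hK : ∀ n, ‖x 0 - w n‖ ≤ K) (n : ℕ) :
    ‖x n - w n‖ ≤ K * lazyWalkSurvival (fun n => α n * (1 - α n)) n 1 +
      2 * ∑ j ∈ Finset.range n, α (j + 1) * (‖e (j + 1)‖ + ε j) + ε n := by
  have := (norm_sub_le_jumpExpectation hα hε hstep hw hK n 0).2
  simp only [jumpExpectation, add_zero] at this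
  linarith

theorem sum_Icc_one_add (f : ℕ → ℝ) (N n : ℕ) :
    ∑ k ∈ Finset.Icc 1 (N + n), f k =
      ∑ k ∈ Finset.Icc 1 N, f k + ∑ k ∈ Finset.Icc 1 n, f (N + k) := by
  induction n with
  | zero => simp
  | succ n ih =>
    rw [← add_assoc, Finset.sum_Icc_succ_top (by omega), ih, Finset.sum_Icc_succ_top (by omega)]
    ring_nf

/-- Asymptotic regularity of a perturbed averaged iteration. -/
theorem tendsto_norm_sub_of_averagedIteration (hα : ∀ n, 1 ≤ n → α n ∈ Set.Icc (0 : ℝ) 1)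
    (hε : ∀ n, 0 ≤ ε n) (hε0 : Tendsto ε atTop (𝓝 0))
    (hstep : ∀ n, x (n + 1) = (1 - α (n + 1)) • x n + α (n + 1) • (w n + e (n + 1)))
    (hw : ∀ m n, ‖w m - w n‖ ≤ ‖x m - x n‖ + ε m + ε n) (hK : ∀ m n, ‖x m - w n‖ ≤ K)
    (hsum : Summable fun j => α (j + 1) * (‖e (j + 1)‖ + ε j))
    (hdiv : Tendsto (fun n : ℕ => ∑ k ∈ Finset.Icc 1 n, α k * (1 - α k)) atTop atTop) :
    Tendsto (fun n => ‖x n - w n‖) atTop (𝓝 0) := by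
  rw [Metric.tendsto_atTop]
  intro η hη
  have htail := tendsto_sum_nat_add fun j => α (j + 1) * (‖e (j + 1)‖ + ε j)
  -- The iteration is restarted at `N`. The tail enters twice, hence `η / 6`; the restart needs the
  -- bound `K` for all pairs of indices.
  obtain ⟨N, hN⟩ := (htail.eventually_lt_const (by positivity : 0 < η / 6)).exists
  have hdivN : Tendsto (fun n : ℕ => ∑ k ∈ Finset.Icc 1 n, α (N + k) * (1 - α (N + k)))
      atTop atTop := by
    have h1 : Tendsto (fun n : ℕ => ∑ k ∈ Finset.Icc 1 (N + n), α k * (1 - α k)) atTop atTop :=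
      hdiv.comp (tendsto_atTop_mono (fun n => Nat.le_add_left _ _) tendsto_id)
    refine (tendsto_atTop_add_const_left atTop (-∑ k ∈ Finset.Icc 1 N, α k * (1 - α k)) h1).congr
      fun n => ?_
    rw [sum_Icc_one_add]
    ring
  have hβ : ∀ n, 1 ≤ n → α (N + n) * (1 - α (N + n)) ∈ Set.Icc (0 : ℝ) (1 / 4) := fun n hn => by
    have ha := hα (N + n) (by omega)
    exact ⟨mul_nonneg ha.1 (sub_nonneg.2 ha.2), by nlinarith [sq_nonneg (α (N + n) - 1 / 2)]⟩
  have hwalk := (tendsto_lazyWalkSurvival_one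
    (β := fun n => α (N + n) * (1 - α (N + n))) hβ hdivN).const_mul K
  rw [mul_zero] at hwalk
  obtain ⟨n₁, hn₁⟩ := eventually_atTop.1 (hwalk.eventually_lt_const (by positivity : 0 < η / 3))
  obtain ⟨n₂, hn₂⟩ := eventually_atTop.1 (hε0.eventually_lt_const (by positivity : 0 < η / 3))
  refine ⟨N + max n₁ n₂, fun n hn => ?_⟩
  obtain ⟨i, rfl⟩ := Nat.exists_eq_add_of_le ((Nat.le_add_right N _).trans hn)
  have hmax := le_max_left n₁ n₂
  have hmax' := le_max_right n₁ n₂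
  have key := norm_sub_le_lazyWalkSurvival (α := fun n => α (N + n)) (ε := fun n => ε (N + n))
    (e := fun n => e (N + n)) (x := fun n => x (N + n)) (w := fun n => w (N + n))
    (fun n hn => hα _ (by omega)) (fun n => hε _) (fun n => hstep (N + n)) (fun m n => hw _ _)
    (fun n => hK _ _) i
  have hle : ∑ j ∈ Finset.range i, α (N + (j + 1)) * (‖e (N + (j + 1))‖ + ε (N + j)) ≤
      ∑' j, α (j + N + 1) * (‖e (j + N + 1)‖ + ε (j + N)) := by
    have hs : Summable fun j => α (j + N + 1) * (‖e (j + N + 1)‖ + ε (j + N)) :=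
      (summable_nat_add_iff N).2 hsum
    refine le_trans (le_of_eq ?_) (hs.sum_le_tsum (Finset.range i) fun j _ =>
      mul_nonneg (hα _ (by omega)).1 (add_nonneg (norm_nonneg _) (hε _)))
    refine Finset.sum_congr rfl fun j _ => ?_
    rw [add_comm j N, add_assoc]
  have h1 := hn₁ i (by omega)
  have h2 := hn₂ (N + i) (by omega)
  rw [dist_zero_right, norm_norm]
  linarith

end AveragedIteration

/-! ### Real recursions with summable perturbations. -/

section RealSequences

variable {a b u : ℕ → ℝ}

/-- A nonnegative sequence with summable increments bounds converges. -/
theorem exists_tendsto_of_le_add_summable (hu : ∀ n, 0 ≤ u n) (hb : ∀ n, 0 ≤ b n)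
    (hsum : Summable b) (h : ∀ n, u (n + 1) ≤ u n + b n) : ∃ l, 0 ≤ l ∧ Tendsto u atTop (𝓝 l) := by
  have hanti : Antitone fun n => u n - ∑ i ∈ Finset.range n, b i := by
    refine antitone_nat_of_succ_le fun n => ?_
    rw [Finset.sum_range_succ]
    linarith [h n]
  have hbdd : BddBelow (Set.range fun n => u n - ∑ i ∈ Finset.range n, b i) := by
    refine ⟨-∑' i, b i, ?_⟩
    rintro _ ⟨n, rfl⟩
    have := hsum.sum_le_tsum (Finset.range n) fun i _ => hb i
    simp only
    linarith [hu n]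
  have hlim := (tendsto_atTop_ciInf hanti hbdd).add hsum.hasSum.tendsto_sum_nat
  simp only [sub_add_cancel] at hlim
  exact ⟨_, ge_of_tendsto' hlim hu, hlim⟩

/-- Telescoping of `a n * u n ≤ u n - u (n + 1) + b n`. -/
theorem summable_mul_of_le_contraction (hu : ∀ n, 0 ≤ u n) (ha : ∀ n, 0 ≤ a n)
    (hb : ∀ n, 0 ≤ b n) (hsum : Summable b) (h : ∀ n, u (n + 1) ≤ (1 - a n) * u n + b n) :
    Summable fun n => a n * u n := by
  refine summable_of_sum_range_le (c := u 0 + ∑' i, b i) (fun n => mul_nonneg (ha n) (hu n))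
    fun n => ?_
  have key : ∑ i ∈ Finset.range n, a i * u i ≤ u 0 - u n + ∑ i ∈ Finset.range n, b i := by
    induction n with
    | zero => simp
    | succ n ih =>
      rw [Finset.sum_range_succ, Finset.sum_range_succ]
      linarith [h n]
  have := hsum.sum_le_tsum (Finset.range n) fun i _ => hb i
  linarith [hu n]

/-- The limit exists; were it `l > 0`, then eventually `a n ≤ (2 / l) * (a n * u n)`, making `a`
summable. -/
theorem tendsto_zero_of_le_contraction (hu : ∀ n, 0 ≤ u n) (ha : ∀ n, 0 ≤ a n)
    (hb : ∀ n, 0 ≤ b n) (hsum : Summable b) (hdiv : ¬ Summable a)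
    (h : ∀ n, u (n + 1) ≤ (1 - a n) * u n + b n) : Tendsto u atTop (𝓝 0) := by
  obtain ⟨l, hl0, hl⟩ := exists_tendsto_of_le_add_summable hu hb hsum fun n => by
    linarith [h n, mul_nonneg (ha n) (hu n)]
  rcases hl0.eq_or_lt with rfl | hpos
  · exact hl
  refine absurd ?_ hdiv
  have hs := (summable_mul_of_le_contraction hu ha hb hsum h).mul_left (2 / l)
  refine hs.of_norm_bounded_eventually_nat ?_
  filter_upwards [hl.eventually_const_le (half_lt_self hpos)] with n hn
  rw [Real.norm_of_nonneg (ha n), div_mul_eq_mul_div, le_div_iff₀ hpos]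
  nlinarith [mul_le_mul_of_nonneg_left hn (ha n)]

theorem not_summable_of_tendsto_sum_mul_one_sub
    (ha : ∀ n, 1 ≤ n → a n ∈ Set.Icc (0 : ℝ) 1)
    (hdiv : Tendsto (fun n : ℕ => ∑ k ∈ Finset.Icc 1 n, a k * (1 - a k)) atTop atTop) :
    ¬ Summable fun n => a (n + 1) := by
  intro hs
  have hle : ∀ n, ∑ k ∈ Finset.Icc 1 n, a k * (1 - a k) ≤ ∑' n, a (n + 1) := fun n => by
    refine le_trans ?_ (hs.sum_le_tsum (Finset.range n) fun i _ => (ha _ (by omega)).1)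
    induction n with
    | zero => simp
    | succ n ih =>
      rw [Finset.sum_Icc_succ_top (by omega), Finset.sum_range_succ]
      have := (ha (n + 1) (by omega)).1
      nlinarith
  obtain ⟨n, hn⟩ := (hdiv.eventually_gt_atTop (∑' n, a (n + 1))).exists
  exact (hle n).not_gt hn

end RealSequences

/-! ### The iteration with approximate projections. -/

section ApproximateProjections

theorem LipschitzOnWith.norm_sub_le_of_one {X : Type*} [NormedAddCommGroup X] {C : Set X} {T : X → X}
    (hT : LipschitzOnWith 1 T C) {u v : X}
    (hu : u ∈ C) (hv : v ∈ C) : ‖T u - T v‖ ≤ ‖u - v‖ := by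
  simpa [dist_eq_norm] using hT.dist_le_mul u hu v hv

theorem summable_step_error {X : Type*} [NormedAddCommGroup X] {α γ : ℕ → ℝ} {e : ℕ → X}
    (hα : ∀ n, 1 ≤ n → α n ∈ Set.Icc (0 : ℝ) 1) (hγ : ∀ n, 0 ≤ γ n)
    (hsum : Summable (fun k : ℕ => α (k + 1) * ‖e (k + 1)‖ + γ (k + 1))) :
    Summable fun k => α (k + 1) * ‖e (k + 1)‖ :=
  hsum.of_nonneg_of_le (fun k => mul_nonneg (hα _ (by omega)).1 (norm_nonneg _))
    fun k => le_add_of_nonneg_right (hγ _)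

theorem summable_proj_error {X : Type*} [NormedAddCommGroup X] {α γ : ℕ → ℝ} {e : ℕ → X}
    (hα : ∀ n, 1 ≤ n → α n ∈ Set.Icc (0 : ℝ) 1) (hγ : ∀ n, 0 ≤ γ n)
    (hsum : Summable (fun k : ℕ => α (k + 1) * ‖e (k + 1)‖ + γ (k + 1))) : Summable γ :=
  (summable_nat_add_iff 1).1 <| hsum.of_nonneg_of_le (fun k => hγ _)
    fun k => le_add_of_nonneg_left (mul_nonneg (hα _ (by omega)).1 (norm_nonneg _))

variable {X : Type*} [NormedAddCommGroup X] [NormedSpace ℝ X]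

/-- Compare with `(1 - a) • c + a • y ∈ C`, where `c ∈ C` is almost nearest to `x`. -/
theorem Convex.infDist_combination_le {C : Set X} (hC : Convex ℝ C) {y : X} (hy : y ∈ C) (x e : X)
    {a : ℝ} (ha : a ∈ Set.Icc (0 : ℝ) 1) :
    Metric.infDist ((1 - a) • x + a • (y + e)) C ≤ (1 - a) * Metric.infDist x C + a * ‖e‖ := by
  refine le_of_forall_pos_le_add fun η hη => ?_
  obtain ⟨c, hc, hlt⟩ := (Metric.infDist_lt_iff (r := Metric.infDist x C + η) ⟨y, hy⟩).1
    (by linarith)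
  have hmem : (1 - a) • c + a • y ∈ C := hC hc hy (sub_nonneg.2 ha.2) ha.1 (by ring)
  refine (Metric.infDist_le_dist_of_mem hmem).trans ?_
  have hdec : (1 - a) • x + a • (y + e) - ((1 - a) • c + a • y) = (1 - a) • (x - c) + a • e := by
    module
  rw [dist_eq_norm] at hlt ⊢
  rw [hdec]
  refine (norm_add_le _ _).trans ?_
  rw [norm_smul, norm_smul, Real.norm_of_nonneg (sub_nonneg.2 ha.2), Real.norm_of_nonneg ha.1]
  nlinarith [mul_le_mul_of_nonneg_left hlt.le (sub_nonneg.2 ha.2), mul_nonneg ha.1 hη.le]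

variable {C : Set X} {T : X → X} {α γ : ℕ → ℝ} {e x z : ℕ → X}

namespace IsApproxProjKM

theorem infDist_succ_le (hiter : IsApproxProjKM C T α γ e x z) (hC : Convex ℝ C)
    (hT : Set.MapsTo T C C) (hα : ∀ n, 1 ≤ n → α n ∈ Set.Icc (0 : ℝ) 1) (n : ℕ) :
    Metric.infDist (x (n + 1)) C ≤
      (1 - α (n + 1)) * Metric.infDist (x n) C + α (n + 1) * ‖e (n + 1)‖ := by
  rw [hiter.step]
  exact hC.infDist_combination_le (hT (hiter.proj_mem n)) _ _ (hα _ (by omega))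

theorem tendsto_infDist_add (hiter : IsApproxProjKM C T α γ e x z) (hC : Convex ℝ C)
    (hT : Set.MapsTo T C C) (hα : ∀ n, 1 ≤ n → α n ∈ Set.Icc (0 : ℝ) 1) (hγ : ∀ n, 0 ≤ γ n)
    (hsum : Summable (fun k : ℕ => α (k + 1) * ‖e (k + 1)‖ + γ (k + 1)))
    (hdiv : Tendsto (fun n : ℕ => ∑ k ∈ Finset.Icc 1 n, α k * (1 - α k)) atTop atTop) :
    Tendsto (fun n => Metric.infDist (x n) C + γ n) atTop (𝓝 0) := by
  have h1 := tendsto_zero_of_le_contraction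
    (u := fun n => Metric.infDist (x n) C) (a := fun n => α (n + 1))
    (b := fun n => α (n + 1) * ‖e (n + 1)‖) (fun n => Metric.infDist_nonneg)
    (fun n => (hα (n + 1) (by omega)).1)
    (fun n => mul_nonneg (hα (n + 1) (by omega)).1 (norm_nonneg _))
    (summable_step_error hα hγ hsum) (not_summable_of_tendsto_sum_mul_one_sub hα hdiv)
    (hiter.infDist_succ_le hC hT hα)
  simpa using h1.add (summable_proj_error hα hγ hsum).tendsto_atTop_zero

theorem summable_total_error (hiter : IsApproxProjKM C T α γ e x z) (hC : Convex ℝ C)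
    (hT : Set.MapsTo T C C) (hα : ∀ n, 1 ≤ n → α n ∈ Set.Icc (0 : ℝ) 1) (hγ : ∀ n, 0 ≤ γ n)
    (hsum : Summable (fun k : ℕ => α (k + 1) * ‖e (k + 1)‖ + γ (k + 1))) :
    Summable fun n => α (n + 1) * (‖e (n + 1)‖ + (Metric.infDist (x n) C + γ n)) := by
  have h1 := summable_mul_of_le_contraction
    (u := fun n => Metric.infDist (x n) C) (a := fun n => α (n + 1))
    (b := fun n => α (n + 1) * ‖e (n + 1)‖) (fun n => Metric.infDist_nonneg)
    (fun n => (hα (n + 1) (by omega)).1)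
    (fun n => mul_nonneg (hα (n + 1) (by omega)).1 (norm_nonneg _))
    (summable_step_error hα hγ hsum) (hiter.infDist_succ_le hC hT hα)
  refine (((summable_step_error hα hγ hsum).add h1).add
    (summable_proj_error hα hγ hsum)).of_nonneg_of_le (fun n => mul_nonneg (hα _ (by omega)).1
      (add_nonneg (norm_nonneg _) (add_nonneg Metric.infDist_nonneg (hγ n)))) fun n => ?_
  have := mul_le_mul_of_nonneg_right (hα (n + 1) (by omega)).2 (hγ n)
  linarith

theorem tendsto_norm_sub_proj (hiter : IsApproxProjKM C T α γ e x z) (hC : Convex ℝ C)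
    (hT : Set.MapsTo T C C) (hα : ∀ n, 1 ≤ n → α n ∈ Set.Icc (0 : ℝ) 1) (hγ : ∀ n, 0 ≤ γ n)
    (hsum : Summable (fun k : ℕ => α (k + 1) * ‖e (k + 1)‖ + γ (k + 1)))
    (hdiv : Tendsto (fun n : ℕ => ∑ k ∈ Finset.Icc 1 n, α k * (1 - α k)) atTop atTop) :
    Tendsto (fun n => ‖x n - z n‖) atTop (𝓝 0) :=
  squeeze_zero (fun _ => norm_nonneg _)
    (fun n => (norm_sub_rev _ _).trans_le (hiter.proj_approx n))
    (hiter.tendsto_infDist_add hC hT hα hγ hsum hdiv)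

theorem tendsto_norm_sub_map (hiter : IsApproxProjKM C T α γ e x z) (hC : Convex ℝ C)
    (hT : Set.MapsTo T C C) (hTn : LipschitzOnWith 1 T C)
    (hα : ∀ n, 1 ≤ n → α n ∈ Set.Icc (0 : ℝ) 1) (hγ : ∀ n, 0 ≤ γ n)
    (he : Tendsto (fun n => ‖e n‖) atTop (𝓝 0))
    (hsum : Summable (fun k : ℕ => α (k + 1) * ‖e (k + 1)‖ + γ (k + 1)))
    (hdiv : Tendsto (fun n : ℕ => ∑ k ∈ Finset.Icc 1 n, α k * (1 - α k)) atTop atTop)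
    {κ : ℝ} (hbound : ∀ n, ‖x 0 - T (z n)‖ ≤ κ) :
    Tendsto (fun n => ‖x n - T (z n)‖) atTop (𝓝 0) := by
  obtain ⟨M, hM⟩ := he.bddAbove_range
  have hM : ∀ n, ‖e n‖ ≤ M := fun n => hM ⟨n, rfl⟩
  -- Each iterate averages the previous one with a point within `κ + M` of `x 0`, so the whole orbit
  -- stays in that ball.
  have hx0 : ∀ n, ‖x n - x 0‖ ≤ κ + M := by
    intro n
    induction n with
    | zero =>
      rw [sub_self, norm_zero]
      linarith [norm_nonneg (x 0 - T (z 0)), hbound 0, norm_nonneg (e 0), hM 0]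
    | succ n ih =>
      have ha := hα (n + 1) (by omega)
      have hc := norm_sub_convexCombination_le ha (x n) (T (z n)) (x 0) (e (n + 1))
      rw [← hiter.step, norm_sub_rev (T (z n))] at hc
      have h1 := mul_le_mul_of_nonneg_left ih (sub_nonneg.2 ha.2)
      have h2 := mul_le_mul_of_nonneg_left (add_le_add (hbound n) (hM (n + 1))) ha.1
      linarith
  refine tendsto_norm_sub_of_averagedIteration (w := fun n => T (z n)) (K := κ + M + κ) hα
    (fun n => add_nonneg Metric.infDist_nonneg (hγ n))
    (hiter.tendsto_infDist_add hC hT hα hγ hsum hdiv) hiter.step (fun m n => ?_) (fun m n => ?_)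
    (hiter.summable_total_error hC hT hα hγ hsum) hdiv
  · refine (hTn.norm_sub_le_of_one (hiter.proj_mem m) (hiter.proj_mem n)).trans ?_
    have h1 := hiter.proj_approx m
    have h2 := hiter.proj_approx n
    have h3 := norm_sub_le_norm_sub_add_norm_sub (z m) (x m) (z n)
    have h4 := norm_sub_le_norm_sub_add_norm_sub (x m) (x n) (z n)
    rw [norm_sub_rev (z n)] at h2
    linarith
  · exact (norm_sub_le_norm_sub_add_norm_sub (x m) (x 0) (T (z n))).trans
      (add_le_add (hx0 m) (hbound n))

/-- The distance to a fixed point converges. -/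
theorem exists_tendsto_norm_sub_fixedPoint (hiter : IsApproxProjKM C T α γ e x z)
    (hC : Convex ℝ C) (hT : Set.MapsTo T C C) (hTn : LipschitzOnWith 1 T C)
    (hα : ∀ n, 1 ≤ n → α n ∈ Set.Icc (0 : ℝ) 1) (hγ : ∀ n, 0 ≤ γ n)
    (hsum : Summable (fun k : ℕ => α (k + 1) * ‖e (k + 1)‖ + γ (k + 1)))
    {p : X} (hp : p ∈ C) (hTp : T p = p) : ∃ l, Tendsto (fun n => ‖x n - p‖) atTop (𝓝 l) := by
  obtain ⟨l, -, hl⟩ := exists_tendsto_of_le_add_summable (u := fun n => ‖x n - p‖)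
    (fun n => norm_nonneg _)
    (fun n => mul_nonneg (hα (n + 1) (by omega)).1
      (add_nonneg (norm_nonneg _) (add_nonneg Metric.infDist_nonneg (hγ n))))
    (hiter.summable_total_error hC hT hα hγ hsum) fun n => by
      have ha := hα (n + 1) (by omega)
      have hc := norm_sub_convexCombination_le ha (x n) (T (z n)) p (e (n + 1))
      rw [← hiter.step] at hc
      have h1 := hTn.norm_sub_le_of_one (hiter.proj_mem n) hp
      rw [hTp] at h1
      have h2 := norm_sub_le_norm_sub_add_norm_sub (z n) (x n) p
      have h3 := hiter.proj_approx n
      have h4 : ‖T (z n) - p‖ ≤ Metric.infDist (x n) C + γ n + ‖x n - p‖ := by linarith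
      have h5 := mul_le_mul_of_nonneg_left h4 ha.1
      linarith
  exact ⟨l, hl⟩

end IsApproxProjKM

end ApproximateProjections

/-! ### Weak limits and Opial's property. -/

section WeakConvergence

variable {X : Type*} [NormedAddCommGroup X] [NormedSpace ℝ X] {C : Set X}

theorem WeaklyConverges.comp_tendsto {u : ℕ → X} {p : X} (h : WeaklyConverges u p)
    {φ : ℕ → ℕ} (hφ : Tendsto φ atTop atTop) : WeaklyConverges (u ∘ φ) p :=
  (show Tendsto (fun n => toWeakSpace ℝ X (u n)) atTop (𝓝 (toWeakSpace ℝ X p)) from h).comp hφ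

theorem WeaklyConverges.of_norm_sub_tendsto {u v : ℕ → X} {p : X} (h : WeaklyConverges u p)
    (huv : Tendsto (fun n => ‖u n - v n‖) atTop (𝓝 0)) : WeaklyConverges v p := by
  rw [weaklyConverges_iff] at h ⊢
  intro f
  have h1 := (f.continuous.tendsto 0).comp (tendsto_zero_iff_norm_tendsto_zero.2 huv)
  rw [map_zero] at h1
  have h2 := (h f).sub h1
  rw [sub_zero] at h2
  refine h2.congr fun n => ?_
  simp

theorem WeaklyConverges.mem_of_isClosed_of_convex {u : ℕ → X} {p : X} (h : WeaklyConverges u p)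
    (hclosed : IsClosed C) (hconv : Convex ℝ C) (hu : ∀ n, u n ∈ C) : p ∈ C := by
  by_contra hp
  obtain ⟨f, c, hf, hc⟩ := geometric_hahn_banach_closed_point hconv hclosed hp
  exact (le_of_tendsto' (weaklyConverges_iff.1 h f) fun n => (hf _ (hu n)).le).not_gt hc

theorem OpialProperty.limit_lt (hX : OpialProperty X) {u : ℕ → X} {p q : X}
    (h : WeaklyConverges u p) (hpq : q ≠ p) {a b : ℝ}
    (ha : Tendsto (fun n => ‖u n - p‖) atTop (𝓝 a))
    (hb : Tendsto (fun n => ‖u n - q‖) atTop (𝓝 b)) : a < b := by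
  have := hX u p h q hpq
  rwa [ha.liminf_eq, hb.liminf_eq] at this

/-- Demiclosedness of `I - T` at zero for nonexpansive maps under Opial's property. -/
theorem OpialProperty.fixedPoint_of_weaklyConverges (hX : OpialProperty X) {T : X → X}
    (hTn : LipschitzOnWith 1 T C) {u : ℕ → X} {p : X} (hu : ∀ n, u n ∈ C) (hp : p ∈ C)
    {M : ℝ} (hM : ∀ n, ‖u n‖ ≤ M) (h : WeaklyConverges u p)
    (hreg : Tendsto (fun n => ‖u n - T (u n)‖) atTop (𝓝 0)) : T p = p := by
  by_contra hne
  have hsub : ∀ (w : ℕ → X) (q : X), (∀ n, ‖w n‖ ≤ M) →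
      ∃ (a : ℝ) (φ : ℕ → ℕ), StrictMono φ ∧ Tendsto (fun n => ‖w (φ n) - q‖) atTop (𝓝 a) := by
    intro w q hw
    obtain ⟨a, -, φ, hφ, ha⟩ := (isCompact_Icc (a := 0) (b := M + ‖q‖)).tendsto_subseq
      (x := fun n => ‖w n - q‖) fun n =>
        ⟨norm_nonneg _, (norm_sub_le _ _).trans (add_le_add (hw n) le_rfl)⟩
    exact ⟨a, φ, hφ, ha⟩
  -- Along a common subsequence the liminfs are limits, and nonexpansiveness gives `b ≤ a`, against
  -- Opial's `a < b`.
  obtain ⟨a, φ, hφ, ha⟩ := hsub u p hM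
  obtain ⟨b, ψ, hψ, hb⟩ := hsub (u ∘ φ) (T p) fun n => hM _
  have ha' := ha.comp hψ.tendsto_atTop
  have hlt := hX.limit_lt (h.comp_tendsto (hφ.comp hψ).tendsto_atTop) hne ha' hb
  have hreg' := (hreg.comp (hφ.comp hψ).tendsto_atTop).add ha'
  rw [zero_add] at hreg'
  refine hlt.not_ge (le_of_tendsto_of_tendsto' hb hreg' fun n => ?_)
  have h1 := norm_sub_le_norm_sub_add_norm_sub (u (φ (ψ n))) (T (u (φ (ψ n)))) (T p)
  have h2 := hTn.norm_sub_le_of_one (hu (φ (ψ n))) hp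
  simp only [Function.comp_apply]
  linarith

end WeakConvergence

/-! ### The convergence theorem. -/

theorem mainTheorem5 {X : Type*} [NormedAddCommGroup X] [NormedSpace ℝ X] [CompleteSpace X]
    (C : Set X) (hCclosed : IsClosed C) (hCconvex : Convex ℝ C)
    (T : X → X) (hTmaps : Set.MapsTo T C C) (hTnonexp : LipschitzOnWith 1 T C)
    (α γ : ℕ → ℝ) (e x z : ℕ → X)
    (hα : ∀ n, 1 ≤ n → α n ∈ Set.Icc (0 : ℝ) 1)
    (hγ : ∀ n, 0 ≤ γ n)
    (hiter : IsApproxProjKM C T α γ e x z)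
    (he : Tendsto (fun n => ‖e n‖) atTop (𝓝 0))
    (hsum : Summable (fun k : ℕ => α (k + 1) * ‖e (k + 1)‖ + γ (k + 1)))
    (hdiv : Tendsto (fun n : ℕ => ∑ k ∈ Finset.Icc 1 n, α k * (1 - α k)) atTop atTop)
    (κ : ℝ) (hκ : 0 ≤ κ) (hbound : ∀ n, ‖x 0 - T (z n)‖ ≤ κ) :
    Tendsto (fun n => ‖x n - z n‖) atTop (𝓝 0) ∧
    Tendsto (fun n => ‖z n - T (z n)‖) atTop (𝓝 0) ∧
    (IsCompact (closure (T '' C)) →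
      ∃ p ∈ C, T p = p ∧ Tendsto x atTop (𝓝 p)) ∧
    (Bornology.IsBounded (Set.range x) → UniformConvexSpace X → OpialProperty X →
      ∃ p ∈ C, T p = p ∧ WeaklyConverges x p) := by
  have hxz := hiter.tendsto_norm_sub_proj hCconvex hTmaps hα hγ hsum hdiv
  have hxT := hiter.tendsto_norm_sub_map hCconvex hTmaps hTnonexp hα hγ he hsum hdiv hbound
  have hzT : Tendsto (fun n => ‖z n - T (z n)‖) atTop (𝓝 0) := by
    refine squeeze_zero (fun n => norm_nonneg _) (fun n => ?_) (by simpa using hxz.add hxT)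
    rw [norm_sub_rev (x n) (z n)]
    exact norm_sub_le_norm_sub_add_norm_sub _ _ _
  have hdist := fun p (hp : p ∈ C) (hTp : T p = p) =>
    hiter.exists_tendsto_norm_sub_fixedPoint hCconvex hTmaps hTnonexp hα hγ hsum hp hTp
  refine ⟨hxz, hzT, fun hcomp => ?_, fun hbdd hUC hOpial => ?_⟩
  · obtain ⟨p, hp, φ, hφ, hlim⟩ := hcomp.tendsto_subseq (x := fun n => T (z n))
      fun n => subset_closure ⟨z n, hiter.proj_mem n, rfl⟩
    have hpC : p ∈ C :=
      hCclosed.mem_of_tendsto hlim (Eventually.of_forall fun n => hTmaps (hiter.proj_mem _))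
    have hshift : ∀ v : ℕ → X, Tendsto (fun n => ‖v n - T (z n)‖) atTop (𝓝 0) →
        Tendsto (v ∘ φ) atTop (𝓝 p) := fun v hv => by
      have h1 := ((tendsto_zero_iff_norm_tendsto_zero.2 hv).comp hφ.tendsto_atTop).add hlim
      rw [zero_add] at h1
      refine h1.congr fun n => ?_
      simp
    have hTz : Tendsto (fun n => T (z (φ n))) atTop (𝓝 (T p)) :=
      (hTnonexp.continuousOn p hpC).tendsto.comp (tendsto_nhdsWithin_iff.2
        ⟨hshift z hzT, Eventually.of_forall fun n => hiter.proj_mem _⟩)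
    have hTp : T p = p := tendsto_nhds_unique hTz hlim
    obtain ⟨l, hl⟩ := hdist p hpC hTp
    have hl0 : l = 0 := tendsto_nhds_unique (hl.comp hφ.tendsto_atTop)
      (tendsto_iff_norm_sub_tendsto_zero.1 (hshift x hxT))
    exact ⟨p, hpC, hTp, tendsto_iff_norm_sub_tendsto_zero.2 (hl0 ▸ hl)⟩
  · obtain ⟨M, hM⟩ := hbdd.exists_norm_le
    have hM : ∀ n, ‖x n‖ ≤ M := fun n => hM _ ⟨n, rfl⟩
    obtain ⟨M', hM'⟩ := hxz.bddAbove_range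
    have hzM : ∀ n, ‖z n‖ ≤ M + M' := fun n => by
      have h1 := norm_sub_norm_le (z n) (x n)
      have h2 : ‖x n - z n‖ ≤ M' := hM' ⟨n, rfl⟩
      rw [norm_sub_rev] at h1
      linarith [hM n]
    have hfix : ∀ (φ : ℕ → ℕ) (p : X), Tendsto φ atTop atTop → WeaklyConverges (x ∘ φ) p →
        p ∈ C ∧ T p = p := fun φ p hφ hp => by
      have hz : WeaklyConverges (z ∘ φ) p := hp.of_norm_sub_tendsto (hxz.comp hφ)
      have hpC := hz.mem_of_isClosed_of_convex hCclosed hCconvex fun n => hiter.proj_mem _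
      exact ⟨hpC, hOpial.fixedPoint_of_weaklyConverges hTnonexp (fun n => hiter.proj_mem _) hpC
        (fun n => hzM _) hz (hzT.comp hφ)⟩
    obtain ⟨p, φ, hφ, hp⟩ := UniformConvexSpace.exists_subseq_weaklyConverges hM
    obtain ⟨hpC, hTp⟩ := hfix φ p hφ.tendsto_atTop hp
    -- It suffices that every subsequence has a further one converging weakly to the same `p`.
    refine ⟨p, hpC, hTp, tendsto_of_subseq_tendsto fun ns hns => ?_⟩
    obtain ⟨q, ψ, hψ, hq⟩ := UniformConvexSpace.exists_subseq_weaklyConverges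
      (u := x ∘ ns) fun n => hM _
    have hnsψ := hns.comp hψ.tendsto_atTop
    obtain ⟨hqC, hTq⟩ := hfix (ns ∘ ψ) q hnsψ hq
    have hqp : q = p := by
      by_contra hne
      obtain ⟨a, ha⟩ := hdist p hpC hTp
      obtain ⟨b, hb⟩ := hdist q hqC hTq
      exact lt_asymm
        (hOpial.limit_lt hp hne (ha.comp hφ.tendsto_atTop) (hb.comp hφ.tendsto_atTop))
        (hOpial.limit_lt (u := x ∘ ns ∘ ψ) hq (Ne.symm hne) (hb.comp hnsψ) (ha.comp hnsψ))
    exact ⟨ψ, hqp ▸ hq⟩
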